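/- Consider a polling system in which a single server visits queues $Q_1,\dots,Q_N$ ($N\ge 1$) in cyclic order, each queue being served according to either the gated or the exhaustive discipline. Queue $Q_j$ has $K_j$ priority levels, level $1$ being the highest. Type $j$ customers of level $k$ arrive according to a Poisson process with rate $\lambda_{jk}\ge 0$, where $\lambda_j:=\sum_{k=1}^{K_j}\lambda_{jk}>0$, and have service times distributed as $B_{jk}$ (an arbitrary nonnegative random variable); the switch from $Q_j$ to $Q_{j+1}$ (indices modulo $N$) takes a random time distributed as $S_j\ge 0$. All arrival processes, service times and switch-over times are independent. During a visit to $Q_j$ the server repeatedly takes, among the customers that are to be served in this visit (gated: those present at the visit beginning; exhaustive: all those present in $Q_j$), a customer of the highest priority level represented and serves him without interruption, until no such customer is left. Suppose that $\rho:=\sum_{j=1}^{N}\sum_{k=1}^{K_j}\lambda_{jk}E(B_{jk})<1$. The corresponding system without priorities has the same queues, disciplines and switch-over times, Poisson arrivals at $Q_j$ with rate $\lambda_j$, and service times at $Q_j$ distributed as $B_j$, the mixture of the laws of $B_{j1},\dots,B_{jK_j}$ with weights $\lambda_{j1}/\lambda_j,\dots,\lambda_{jK_j}/\lambda_j$. In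 either system, a steady state at visit beginnings is a family of probability laws $(P_1,\dots,P_N)$ of the joint queue lengths such that, for every $i$, if the joint queue lengths at a visit beginning to $Q_i$ have law $P_i$, then those at the next visit beginning to $Q_{i+1}$ have law $P_{i+1}$ (indices modulo $N$). Suppose that the system without priorities is in steady state at visit beginnings, and let $V_{b_i}(z_1,\dots,z_N)$ be the generating function of the joint queue lengths $(X_{i1},\dots,X_{iN})$ at a visit beginning to $Q_i$. Then the system with priorities has exactly one steady state at visit beginnings, and if $V^{\mathrm{prio}}_{b_i}(z_{11},\dots,z_{1K_1},\dots,z_{N1},\dots,z_{NK_N})=E\big[\prod_{j=1}^N\prod_{k=1}^{K_j}z_{jk}^{X_{ijk}}\big]$ denotes in it the generating function of the numbers $X_{ijk}$ of type $j$ customers of level $k$ present at a visit beginning to $Q_i$, then for all $i=1,\dots,N$ and all complex $z_{jk}$ with $|z_{jk}|\le 1$, $$V^{\mathrm{prio}}_{b_i}(z_{11},\dots,z_{1K_1},\dots,z_{N1},\dots,z_{NK_N}) = V_{b_i}\left(\frac{1}{\lambda_1}\sum_{k=1}^{K_1}\lambda_{1k} z_{1k},\ \dots,\ \frac{1}{\lambda_N}\sum_{k=1}^{K_N}\lambda_{Nk}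 z_{Nk}\right).$$ -/

import Mathlib

open MeasureTheory ProbabilityTheory
open scoped NNReal ENNReal

namespace Polling

/-- The two service disciplines. -/
inductive Discipline
  | gated
  | exhaustive
  deriving DecidableEq

/-- Joint queue lengths: `x j k` is the number of type `j` customers of priority level `k` that are
present. Queue `j` has `K j` levels; level `0` has the highest priority. -/
abbrev State {N : ℕ} (K : Fin N → ℕ) : Type := (j : Fin N) → Fin (K j) → ℕ

/-- The data of a cyclic single-server polling system with `N` queues and `K j` priority levels
in queue `j`. A system without priorities is one with `K j = 1` for all `j`. -/
structure System (N : ℕ) (K : Fin N → ℕ) where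
  /-- the service discipline of each queue -/
  discipline : Fin N → Discipline
  /-- `rate j k` is the intensity of the Poisson arrival process of type `j`, level `k` -/
  rate : (j : Fin N) → Fin (K j) → ℝ≥0
  /-- every queue has a positive total arrival rate -/
  rate_pos : ∀ j, 0 < ∑ k, rate j k
  /-- `service j k` is the law of the service time of a type `j` customer of level `k` -/
  service : (j : Fin N) → Fin (K j) → ProbabilityMeasure ℝ≥0
  /-- `switchover j` is the law of the time the server needs to go from queue `j` to the next -/
  switchover : Fin N → ProbabilityMeasure ℝ≥0

namespace System

variable {N : ℕ} {K : Fin N → ℕ} (M : System N K)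

/-- The total arrival rate `λ_j` at queue `j`. -/
noncomputable def totalRate (j : Fin N) : ℝ≥0 := ∑ k, M.rate j k

/-- The fraction of time `ρ` that the server is working. -/
noncomputable def load : ℝ≥0∞ :=
  ∑ j, ∑ k, (M.rate j k : ℝ≥0∞) * ∫⁻ t : ℝ≥0, (t : ℝ≥0∞) ∂(M.service j k : Measure ℝ≥0)

/-- The probability that the joint numbers of arrivals, during a random time with law `τ` that is
independent of the (independent, Poisson) arrival processes, are equal to `a`. -/
noncomputable def arrivals (τ : ProbabilityMeasure ℝ≥0) (a : State K) : ℝ≥0∞ :=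
  ∫⁻ t : ℝ≥0, ∏ j, ∏ k, poissonMeasure (M.rate j k * t) {a j k} ∂(τ : Measure ℝ≥0)

/-- Removal of one type `i` customer of level `k`. -/
def depart (x : State K) (i : Fin N) (k : Fin (K i)) : State K :=
  Function.update x i (Function.update (x i) k (x i k - 1))

/-- `g` counts, by level, the customers of queue `i` that are still to be served in the current
visit as far as known. This is the same vector after the service of a level `k` customer that left
the joint queue lengths `x'`: under gated service the customers who arrive during the visit do not
count, under exhaustive service everybody present in the queue counts. -/
def entitled (i : Fin N) (g : Fin (K i) → ℕ) (k : Fin (K i)) (x' : State K) : Fin (K i) → ℕ :=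
  match M.discipline i with
  | .gated => Function.update g k (g k - 1)
  | .exhaustive => x' i

/-- The probability that a visit to queue `i`, at an epoch at which no service is in progress, the
joint queue lengths are `x` and the customers still to be served are `g`, ends after exactly `n`
further services and leaves the joint queue lengths `y`. The server always takes a customer of the
highest priority level that is represented in `g`, and serves him without interruption. -/
noncomputable def visitIn (i : Fin N) : ℕ → State K → (Fin (K i) → ℕ) → State K → ℝ≥0∞
  | 0, x, g, y => open Classical in if g = 0 ∧ x = y then 1 else 0
  | n + 1, x, g, y => open Classical in
      ∑ k, if 0 < g k ∧ ∀ l < k, g l = 0 then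
        ∑' a, M.arrivals (M.service i k) a *
          visitIn i n (depart x i k + a) (M.entitled i g k (depart x i k + a)) y
      else 0

/-- The probability that a visit to queue `i` that begins with joint queue lengths `x` ends, and
leaves the joint queue lengths `y`. -/
noncomputable def visit (i : Fin N) (x y : State K) : ℝ≥0∞ := ∑' n, M.visitIn i n x (x i) y

/-- The probability that the switch from queue `i` to the next queue changes the joint queue lengths
from `x` to `y`. -/
noncomputable def switch (i : Fin N) (x y : State K) : ℝ≥0∞ :=
  open Classical in ∑' a, if x + a = y then M.arrivals (M.switchover i) a else 0

/-- The transition probability of the joint queue lengths from a visit beginning to queue `i` to the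
next visit beginning, to queue `i + 1` (modulo `N`). -/
noncomputable def step (i : Fin N) (x y : State K) : ℝ≥0∞ := ∑' u, M.visit i x u * M.switch i u y

/-- `P i` is the steady-state law of the joint queue lengths at a visit beginning to queue `i`, for
all `i`: the laws are reproduced as the server moves around the cycle. -/
def IsSteadyState [NeZero N] (P : Fin N → PMF (State K)) : Prop :=
  ∀ i y, P (i + 1) y = ∑' x, P i x * M.step i x y

/-- The service time of an arbitrary type `j` customer: the mixture of the laws of the service times
of the levels with weights `λ_{jk} / λ_j`. -/
noncomputable def mixedService (j : Fin N) : ProbabilityMeasure ℝ≥0 :=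
  ⟨∑ k, (M.rate j k / M.totalRate j) • (M.service j k : Measure ℝ≥0), ⟨by
    have h : M.totalRate j ≠ 0 := (M.rate_pos j).ne'
    have h1 : ∑ k, M.rate j k / M.totalRate j = 1 := by
      rw [← Finset.sum_div]; exact div_self h
    simp only [Measure.coe_finsetSum, Finset.sum_apply, Measure.smul_apply, measure_univ]
    simp only [ENNReal.smul_def, smul_eq_mul, mul_one]
    exact_mod_cast h1⟩⟩

/-- The system without priorities: the same queues, disciplines and switch-over times, with a
single level in queue `j`, arrival rate `λ_j` and service times of arbitrary type `j` customers. -/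
noncomputable def withoutPriorities : System N (fun _ => 1) where
  discipline := M.discipline
  rate j _ := M.totalRate j
  rate_pos j := by simpa [totalRate] using M.rate_pos j
  service j _ := M.mixedService j
  switchover := M.switchover

end System

/-- The generating function of a law of joint queue lengths. The series converges absolutely when
`‖z j k‖ ≤ 1` for all `j` and `k`. -/
noncomputable def genFun {N : ℕ} {K : Fin N → ℕ} (p : PMF (State K))
    (z : (j : Fin N) → Fin (K j) → ℂ) : ℂ :=
  ∑' n : State K, ((p n).toReal : ℂ) * ∏ j, ∏ k, z j k ^ n j k

end Polling

/-! Give every customer of the system without priorities an independent random level, level `k` in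
queue `j` with probability `λ_jk / λ_j` (`labelWeight`, `labelMean`). This labelling intertwines the
two transition kernels (`labelMean_step`): labelling and then moving with priorities has the same
law as moving without priorities and then labelling. Two facts carry this. By Poisson thinning, the
levels of the arrivals are independent of each other, of their numbers and of the elapsed time
(`arrivals_eq`). And the law of the outcome of a visit does not depend on which entitled customer
goes first (`continueVisit_succ`), because two successive independent services can be exchanged.
Hence the server may take a customer whose level is still random, and his service time then has the
mixed law.

It follows that labelling a steady state gives a steady state with priorities
(`isSteadyState_labelled`), and the multinomial theorem gives its generating function
(`genFun_labelled`).

Uniqueness (`IsSteadyState.unique`): transitions create no mass, so the positive part of the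
difference of two steady states, followed around the closed cycle, is itself invariant. If it is
nonzero it charges the empty state, since with positive probability nobody arrives during a whole
cycle. Exchanging the two steady states gives the opposite strict inequality at the empty state. -/

namespace Polling

/-! ### Independent random levels. -/

section Labelling

variable {N : ℕ} {K : Fin N → ℕ}

/-- The queue lengths, irrespective of the priority levels. -/
def total (x : State K) : State (fun _ : Fin N => 1) := fun j _ => ∑ k, x j k

/-- The state in which the only customer is one of type `j` and level `k`. -/
def customer (j : Fin N) (k : Fin (K j)) : State K := Pi.single j (Pi.single k 1)

lemma total_apply (x : State K) (j : Fin N) (l : Fin 1) : total x j l = ∑ k, x j k := rfl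

@[simp] lemma total_zero : total (0 : State K) = 0 := by
  ext j l; simp [total]

lemma total_add (x y : State K) : total (x + y) = total x + total y := by
  ext j l; simp [total, Finset.sum_add_distrib]

lemma total_single (i : Fin N) (v : Fin (K i) → ℕ) :
    total (Pi.single i v : State K) = Pi.single i (fun _ => ∑ k, v k) := by
  ext j l
  rcases eq_or_ne j i with rfl | h
  · simp [total]
  · simp [total, Pi.single_eq_of_ne h]

lemma total_customer (i : Fin N) (k : Fin (K i)) :
    total (customer i k : State K) = customer i 0 := by
  rw [customer, total_single, customer]
  congr 1
  ext l
  simp [Subsingleton.elim l 0]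

lemma apply_eq_zero_of_total {x : State K} {j : Fin N} (h : total x j = 0) : x j = 0 := by
  ext k
  have h0 : ∑ k, x j k = 0 := congrFun h 0
  exact Finset.sum_eq_zero_iff.1 h0 k (Finset.mem_univ k)

lemma total_eq_zero_iff {x : State K} : total x = 0 ↔ x = 0 := by
  refine ⟨fun h => ?_, fun h => by simp [h]⟩
  ext1 j
  exact apply_eq_zero_of_total (congrFun h j)

lemma exists_eq_add_customer {x : State K} {j : Fin N} {k : Fin (K j)} (h : 0 < x j k) :
    ∃ x', x = x' + customer j k := by
  refine ⟨x - customer j k, ?_⟩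
  refine (tsub_add_cancel_of_le ?_).symm
  intro a b
  rcases eq_or_ne a j with rfl | ha
  · rcases eq_or_ne b k with rfl | hb
    · simpa [customer, Nat.succ_le_iff] using h
    · simp [customer, Pi.single_eq_of_ne hb]
  · simp [customer, Pi.single_eq_of_ne ha]

lemma State.induction {p : State K → Prop} (zero : p 0)
    (step : ∀ x j k, p x → p (x + customer j k)) (x : State K) : p x := by
  suffices H : ∀ (n : ℕ) (x : State K), ∑ j, ∑ k, x j k = n → p x from H _ x rfl
  intro n
  induction n with
  | zero =>
    intro x hx
    have : x = 0 := by
      ext j k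
      have h1 := Finset.sum_eq_zero_iff.1 hx j (Finset.mem_univ j)
      exact Finset.sum_eq_zero_iff.1 h1 k (Finset.mem_univ k)
    rwa [this]
  | succ n ih =>
    intro x hx
    obtain ⟨j, k, h⟩ : ∃ j k, 0 < x j k := by
      by_contra! h
      have : ∑ j, ∑ k, x j k = 0 :=
        Finset.sum_eq_zero fun j _ => Finset.sum_eq_zero fun k _ => Nat.le_zero.1 (h j k)
      omega
    obtain ⟨x', rfl⟩ := exists_eq_add_customer h
    refine step _ _ _ (ih _ ?_)
    have h1 : ∑ a, ∑ b, (customer j k : State K) a b = 1 := by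
      rw [Finset.sum_eq_single j]
      · simp [customer]
      · intro b _ hb
        simp [customer, Pi.single_eq_of_ne hb]
      · simp
    simp only [Pi.add_apply, Finset.sum_add_distrib, h1] at hx
    omega

variable (M : System N K)

namespace System

/-- The probability that a type `j` customer has level `k`. -/
noncomputable def levelProb (j : Fin N) (k : Fin (K j)) : ℝ≥0 := M.rate j k / M.totalRate j

lemma totalRate_ne_zero (j : Fin N) : M.totalRate j ≠ 0 := (M.rate_pos j).ne'

lemma levelProb_mul_totalRate (j : Fin N) (k : Fin (K j)) :
    M.levelProb j k * M.totalRate j = M.rate j k :=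
  div_mul_cancel₀ _ (M.totalRate_ne_zero j)

lemma sum_levelProb (j : Fin N) : ∑ k, M.levelProb j k = 1 := by
  simp only [levelProb]
  rw [← Finset.sum_div]
  exact div_self (M.totalRate_ne_zero j)

/-- The probability that independent random levels of the customers turn the joint queue lengths
`total x` into `x`. -/
noncomputable def labelWeight (x : State K) : ℝ≥0 :=
  ∏ j, (Nat.multinomial Finset.univ (x j) * ∏ k, M.levelProb j k ^ x j k)

lemma labelWeight_zero : M.labelWeight 0 = 1 := by
  simp [labelWeight, Nat.multinomial]

lemma multinomial_add_single {n : ℕ} (v : Fin n → ℕ) (k : Fin n) :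
    Nat.multinomial Finset.univ (v + Pi.single k 1) * (v k + 1) =
      Nat.multinomial Finset.univ v * (∑ l, v l + 1) := by
  have h1 := Nat.multinomial_spec Finset.univ (v + Pi.single k 1)
  have h2 := Nat.multinomial_spec Finset.univ v
  have h3 : ∏ l, ((v + Pi.single k 1 : Fin n → ℕ) l).factorial = (v k + 1) * ∏ l, (v l).factorial := by
    rw [← Finset.mul_prod_erase _ _ (Finset.mem_univ k),
      ← Finset.mul_prod_erase _ (fun l => (v l).factorial) (Finset.mem_univ k)]
    rw [← mul_assoc]
    congr 1
    · simp [Nat.factorial_succ]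
    · refine Finset.prod_congr rfl fun l hl => ?_
      simp [Pi.single_eq_of_ne (Finset.ne_of_mem_erase hl)]
  have h4 : ∑ l, (v + Pi.single k 1 : Fin n → ℕ) l = ∑ l, v l + 1 := by
    simp [Finset.sum_add_distrib]
  rw [h3, h4, Nat.factorial_succ, ← h2] at h1
  have hpos : 0 < ∏ l, (v l).factorial := Finset.prod_pos fun l _ => Nat.factorial_pos _
  apply Nat.eq_of_mul_eq_mul_left hpos
  linear_combination h1

/-- The multinomial recursion, kept free of division; the factors `x j k + 1` and `total x j 0 + 1`
count the ways to mark one customer. -/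
lemma labelWeight_add_customer (x : State K) (j : Fin N) (k : Fin (K j)) :
    M.labelWeight (x + customer j k) * (x j k + 1) =
      M.labelWeight x * ((total x j 0 + 1) * M.levelProb j k) := by
  rw [labelWeight, labelWeight, ← Finset.mul_prod_erase _ _ (Finset.mem_univ j),
    ← Finset.mul_prod_erase _ (fun j => _ * _) (Finset.mem_univ j)]
  have h1 : ∏ a ∈ Finset.univ.erase j, ((Nat.multinomial Finset.univ ((x + customer j k) a) : ℝ≥0) *
      ∏ b, M.levelProb a b ^ (x + customer j k) a b) =
      ∏ a ∈ Finset.univ.erase j, ((Nat.multinomial Finset.univ (x a) : ℝ≥0) *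
        ∏ b, M.levelProb a b ^ x a b) := by
    refine Finset.prod_congr rfl fun a ha => ?_
    have : (x + customer j k) a = x a := by
      simp [customer, Pi.single_eq_of_ne (Finset.ne_of_mem_erase ha)]
    rw [this]
  have h2 : (x + customer j k) j = x j + Pi.single k 1 := by simp [customer]
  have h3 : ∏ b, M.levelProb j b ^ (x j + Pi.single k 1 : Fin (K j) → ℕ) b =
      M.levelProb j k * ∏ b, M.levelProb j b ^ x j b := by
    simp only [Pi.add_apply, pow_add, Finset.prod_mul_distrib]
    rw [mul_comm]
    congr 1
    rw [Finset.prod_eq_single k]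
    · simp
    · intro b _ hb
      simp [Pi.single_eq_of_ne hb]
    · simp
  have h4 : (Nat.multinomial Finset.univ (x j + Pi.single k 1) : ℝ≥0) * (x j k + 1) =
      Nat.multinomial Finset.univ (x j) * (∑ l, (x j l : ℝ≥0) + 1) := by
    exact_mod_cast multinomial_add_single (x j) k
  rw [h1, h2, h3, total_apply]
  push_cast
  linear_combination (M.levelProb j k * (∏ b, M.levelProb j b ^ x j b) *
    ∏ a ∈ Finset.univ.erase j, ((Nat.multinomial Finset.univ (x a) : ℝ≥0) *
        ∏ b, M.levelProb a b ^ x a b)) * h4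

/-- The mean of `F` over the states that arise from the queue lengths `m` when the customers are
given independent random levels. -/
noncomputable def labelMean (m : State (fun _ : Fin N => 1)) (F : State K → ℝ≥0∞) : ℝ≥0∞ :=
  ∑' x, if total x = m then M.labelWeight x * F x else 0

lemma labelMean_congr {m : State (fun _ : Fin N => 1)} {F G : State K → ℝ≥0∞}
    (h : ∀ x, total x = m → F x = G x) : M.labelMean m F = M.labelMean m G := by
  refine tsum_congr fun x => ?_
  split_ifs with hx
  · rw [h x hx]
  · rfl

lemma labelMean_zero (F : State K → ℝ≥0∞) : M.labelMean 0 F = F 0 := by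
  rw [labelMean, tsum_eq_single 0]
  · simp [labelWeight_zero]
  · intro x hx
    rw [if_neg (by rwa [total_eq_zero_iff])]

lemma labelMean_const_mul (m : State (fun _ : Fin N => 1)) (c : ℝ≥0∞) (F : State K → ℝ≥0∞) :
    M.labelMean m (fun x => c * F x) = c * M.labelMean m F := by
  rw [labelMean, labelMean, ← ENNReal.tsum_mul_left]
  refine tsum_congr fun x => ?_
  split_ifs
  · ring
  · simp

lemma labelMean_tsum {ι : Type*} (m : State (fun _ : Fin N => 1)) (F : ι → State K → ℝ≥0∞) :
    M.labelMean m (fun x => ∑' a, F a x) = ∑' a, M.labelMean m (F a) := by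
  simp only [labelMean]
  rw [ENNReal.tsum_comm]
  refine tsum_congr fun x => ?_
  split_ifs
  · rw [ENNReal.tsum_mul_left]
  · simp

lemma labelMean_sum {ι : Type*} [Fintype ι] (m : State (fun _ : Fin N => 1))
    (F : ι → State K → ℝ≥0∞) :
    M.labelMean m (fun x => ∑ a, F a x) = ∑ a, M.labelMean m (F a) := by
  simpa only [tsum_fintype] using M.labelMean_tsum m F

lemma labelMean_comm (m m' : State (fun _ : Fin N => 1)) (F : State K → State K → ℝ≥0∞) :
    M.labelMean m (fun x => M.labelMean m' (F x)) =
      M.labelMean m' (fun y => M.labelMean m (fun x => F x y)) := by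
  have h : ∀ x, M.labelMean m' (F x) =
      ∑' y, (if total y = m' then (M.labelWeight y : ℝ≥0∞) else 0) * F x y := fun x =>
    tsum_congr fun y => by split_ifs <;> simp
  simp only [h]
  rw [labelMean_tsum]
  refine tsum_congr fun y => ?_
  rw [labelMean_const_mul]
  split_ifs <;> simp

/-- Averaging over the levels of all possible arrivals, grouped by their total numbers. -/
lemma tsum_total_mul (f : State (fun _ : Fin N => 1) → ℝ≥0∞) (F : State K → ℝ≥0∞) :
    ∑' x, f (total x) * M.labelWeight x * F x = ∑' m, f m * M.labelMean m F := by
  simp only [labelMean, ← ENNReal.tsum_mul_left]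
  rw [ENNReal.tsum_comm]
  refine tsum_congr fun x => ?_
  rw [tsum_eq_single (total x)]
  · simp [mul_assoc]
  · intro m hm
    rw [if_neg hm.symm, mul_zero]

lemma labelMean_ite_eq (m : State (fun _ : Fin N => 1)) (y : State K) :
    M.labelMean m (fun x => if x = y then 1 else 0) =
      if m = total y then (M.labelWeight y : ℝ≥0∞) else 0 := by
  rw [labelMean, tsum_eq_single y]
  · simp [eq_comm]
  · intro x hx
    simp [hx]

lemma tsum_eq_tsum_add_customer (j : Fin N) (k : Fin (K j)) (F : State K → ℝ≥0∞)
    (hF : ∀ x, x j k = 0 → F x = 0) : ∑' x, F x = ∑' x, F (x + customer j k) := by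
  have hinj : Function.Injective fun x : State K => x + customer j k :=
    add_left_injective _
  refine (hinj.tsum_eq ?_).symm
  intro x hx
  by_contra h
  refine hx (hF x ?_)
  by_contra h0
  obtain ⟨x', rfl⟩ := exists_eq_add_customer (Nat.pos_of_ne_zero h0)
  exact h ⟨x', rfl⟩

/-- Giving a level to one customer first. -/
lemma labelMean_add_customer (m : State (fun _ : Fin N => 1)) (j : Fin N) (F : State K → ℝ≥0∞) :
    M.labelMean (m + customer j 0) F =
      ∑ k, (M.levelProb j k : ℝ≥0∞) * M.labelMean m (fun x => F (x + customer j k)) := by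
  -- Multiply by the number of type `j` customers and write it as the sum of `x j k` over the
  -- levels: this marks one customer, who is then removed with `labelWeight_add_customer`.
  have hne : ((m j 0 + 1 : ℕ) : ℝ≥0∞) ≠ 0 := by simp
  refine (ENNReal.mul_right_inj hne (ENNReal.natCast_ne_top _)).1 ?_
  have h1 : ((m j 0 + 1 : ℕ) : ℝ≥0∞) * M.labelMean (m + customer j 0) F =
      ∑' x : State K, ∑ k, if total x = m + customer j 0 then
        (x j k : ℝ≥0∞) * (M.labelWeight x * F x) else 0 := by
    rw [labelMean, ← ENNReal.tsum_mul_left]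
    refine tsum_congr fun x => ?_
    split_ifs with hx
    · rw [← Finset.sum_mul]
      congr 1
      have := congrFun (congrFun hx j) 0
      rw [total_apply] at this
      simp only [customer, Pi.add_apply, Pi.single_eq_same] at this
      exact_mod_cast this.symm
    · simp
  rw [h1, Summable.tsum_finsetSum fun _ _ => ENNReal.summable, Finset.mul_sum]
  refine Finset.sum_congr rfl fun k _ => ?_
  rw [tsum_eq_tsum_add_customer j k _ (fun x hx => by simp [hx]), labelMean,
    ← ENNReal.tsum_mul_left, ← ENNReal.tsum_mul_left]
  refine tsum_congr fun x => ?_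
  simp only [total_add, total_customer, add_left_inj]
  split_ifs with hx
  · have hw := M.labelWeight_add_customer x j k
    rw [hx] at hw
    have hw' : (M.labelWeight (x + customer j k) : ℝ≥0∞) * ((x j k + 1 : ℕ) : ℝ≥0∞) =
        M.labelWeight x * (((m j 0 + 1 : ℕ) : ℝ≥0∞) * M.levelProb j k) := by
      have := congrArg (fun a : ℝ≥0 => (a : ℝ≥0∞)) hw
      push_cast at this ⊢
      exact this
    have hc : (x + customer j k) j k = x j k + 1 := by simp [customer]
    rw [hc]
    calc _ = (M.labelWeight (x + customer j k) : ℝ≥0∞) * ((x j k + 1 : ℕ) : ℝ≥0∞) *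
          F (x + customer j k) := by ring
      _ = _ := by rw [hw']; ring
  · simp

/-- Two groups of customers are labelled independently; the second group is built up one customer at
a time. -/
lemma labelMean_add (m m' : State (fun _ : Fin N => 1)) (F : State K → ℝ≥0∞) :
    M.labelMean (m + m') F = M.labelMean m (fun x => M.labelMean m' (fun y => F (x + y))) := by
  induction m' using State.induction generalizing F with
  | zero => simp [labelMean_zero]
  | step m' j k ih =>
    rw [Subsingleton.elim k 0, ← add_assoc, labelMean_add_customer]
    simp only [labelMean_add_customer, labelMean_sum, labelMean_const_mul]
    refine Finset.sum_congr rfl fun l _ => ?_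
    rw [ih]
    simp only [add_assoc]

lemma labelMean_one (m : State (fun _ : Fin N => 1)) : M.labelMean m (fun _ => 1) = 1 := by
  induction m using State.induction with
  | zero => simp [labelMean_zero]
  | step m j k ih =>
    rw [Subsingleton.elim k 0, labelMean_add_customer]
    simp only [ih, mul_one]
    exact_mod_cast M.sum_levelProb j

end System

end Labelling

end Polling

namespace Polling
namespace System

variable {N : ℕ} {K : Fin N → ℕ} (M : System N K)

/-! ### Poisson arrivals and thinning. -/

lemma measurable_poissonMeasure_singleton (r : ℝ≥0) (n : ℕ) :
    Measurable fun t : ℝ≥0 => poissonMeasure (r * t) {n} := by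
  simp only [poissonMeasure_singleton]
  fun_prop

lemma measurable_prod_poissonMeasure (a : State K) :
    Measurable fun t : ℝ≥0 => ∏ j, ∏ k, poissonMeasure (M.rate j k * t) {a j k} :=
  Finset.measurable_prod _ fun _ _ => Finset.measurable_prod _ fun _ _ =>
    measurable_poissonMeasure_singleton _ _

lemma tsum_prod_poissonMeasure (t : ℝ≥0) :
    ∑' a : State K, ∏ j, ∏ k, poissonMeasure (M.rate j k * t) {a j k} = 1 := by
  let μ : Measure (State K) :=
    Measure.pi fun j => Measure.pi fun k => poissonMeasure (M.rate j k * t)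
  have h : ∀ a : State K, ∏ j, ∏ k, poissonMeasure (M.rate j k * t) {a j k} = μ {a} := by
    intro a
    simp only [μ, Measure.pi_singleton]
  simp only [h]
  have h1 := lintegral_countable' (μ := μ) (fun _ => (1 : ℝ≥0∞))
  simpa using h1.symm

lemma tsum_arrivals (τ : ProbabilityMeasure ℝ≥0) : ∑' a, M.arrivals τ a = 1 := by
  simp only [arrivals]
  rw [← lintegral_tsum fun a => (M.measurable_prod_poissonMeasure a).aemeasurable]
  simp [tsum_prod_poissonMeasure]

lemma arrivals_zero_pos (τ : ProbabilityMeasure ℝ≥0) : 0 < M.arrivals τ 0 := by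
  rw [arrivals, lintegral_pos_iff_support (M.measurable_prod_poissonMeasure 0)]
  have : Function.support
      (fun t : ℝ≥0 => ∏ j, ∏ k, poissonMeasure (M.rate j k * t) {(0 : State K) j k}) =
      Set.univ := by
    refine Set.eq_univ_of_forall fun t => ?_
    simp only [Function.mem_support, Finset.prod_ne_zero_iff]
    intro j _ k _
    simp [poissonMeasure_singleton, Real.exp_pos]
  rw [this]
  simp

/-- Independent thinning of a Poisson distribution. -/
lemma prod_poissonMeasure_singleton {n : ℕ} (p : Fin n → ℝ≥0) (hp : ∑ k, p k = 1) (r : ℝ≥0)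
    (v : Fin n → ℕ) :
    ∏ k, poissonMeasure (p k * r) {v k} =
      poissonMeasure r {∑ k, v k} *
        ((Nat.multinomial Finset.univ v * ∏ k, p k ^ v k : ℝ≥0) : ℝ≥0∞) := by
  simp only [poissonMeasure_singleton]
  rw [← ENNReal.ofReal_prod_of_nonneg (fun _ _ => by positivity), ← ENNReal.ofReal_coe_nnreal,
    ← ENNReal.ofReal_mul (by positivity)]
  congr 1
  have hp' : ∑ k, (p k : ℝ) = 1 := by exact_mod_cast congrArg (fun a : ℝ≥0 => (a : ℝ)) hp
  have h1 : ∏ k, Real.exp (-(p k * r : ℝ≥0)) = Real.exp (-r) := by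
    rw [← Real.exp_sum]
    push_cast
    rw [Finset.sum_neg_distrib, ← Finset.sum_mul, hp', one_mul]
  have h2 : (∏ k, ((v k).factorial : ℝ)) * Nat.multinomial Finset.univ v =
      ((∑ k, v k).factorial : ℕ) := by
    exact_mod_cast Nat.multinomial_spec Finset.univ v
  have h3 : (∏ k, ((v k).factorial : ℝ)) ≠ 0 :=
    Finset.prod_ne_zero_iff.2 fun k _ => by positivity
  have h4 : (((∑ k, v k).factorial : ℕ) : ℝ) ≠ 0 := by positivity
  rw [Finset.prod_div_distrib, Finset.prod_mul_distrib, h1]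
  push_cast
  simp only [mul_pow, Finset.prod_mul_distrib, Finset.prod_pow_eq_pow_sum]
  rw [div_mul_eq_mul_div, div_eq_div_iff h3 h4, ← h2]
  ring

/-- The arrivals get independent random levels. -/
lemma prod_prod_poissonMeasure (t : ℝ≥0) (a : State K) :
    ∏ j, ∏ k, poissonMeasure (M.rate j k * t) {a j k} =
      (∏ j, ∏ l, poissonMeasure (M.withoutPriorities.rate j l * t) {total a j l}) *
        M.labelWeight a := by
  rw [labelWeight, ENNReal.ofNNReal_finsetProd, ← Finset.prod_mul_distrib]
  refine Finset.prod_congr rfl fun j _ => ?_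
  have h := prod_poissonMeasure_singleton (M.levelProb j) (M.sum_levelProb j)
    (M.totalRate j * t) (a j)
  simp only [← mul_assoc, levelProb_mul_totalRate] at h
  rw [h]
  simp [withoutPriorities, total_apply]

lemma arrivals_eq (τ : ProbabilityMeasure ℝ≥0) (a : State K) :
    M.arrivals τ a = M.withoutPriorities.arrivals τ (total a) * M.labelWeight a := by
  simp only [arrivals]
  rw [← lintegral_mul_const _ (M.withoutPriorities.measurable_prod_poissonMeasure (total a))]
  exact lintegral_congr fun t => M.prod_prod_poissonMeasure t a

/-- A served customer of random level has a service time with the mixed law. -/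
lemma sum_levelProb_mul_arrivals (j : Fin N) (a : State (fun _ : Fin N => 1)) :
    ∑ k, (M.levelProb j k : ℝ≥0∞) * M.withoutPriorities.arrivals (M.service j k) a =
      M.withoutPriorities.arrivals (M.mixedService j) a := by
  simp only [arrivals, mixedService, ProbabilityMeasure.coe_mk]
  rw [lintegral_finsetSum_measure]
  refine Finset.sum_congr rfl fun k _ => ?_
  rw [lintegral_smul_measure]
  rfl

/-! ### Visits, and independence of the order of service. -/

/-- Among the arrivals `a` during a service in queue `i`, those served in the current visit. -/
def joining (i : Fin N) (a : State K) : State K :=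
  match M.discipline i with
  | .gated => 0
  | .exhaustive => Pi.single i (a i)

/-- Among the arrivals `a` during a service in queue `i`, those not served in the current visit. -/
def waiting (i : Fin N) (a : State K) : State K :=
  match M.discipline i with
  | .gated => a
  | .exhaustive => Function.update a i 0

lemma update_add_single (i : Fin N) (a : State K) :
    Function.update a i 0 + Pi.single i (a i) = a := by
  ext1 j
  rcases eq_or_ne j i with rfl | h
  · simp
  · simp [h]

lemma waiting_add_joining (i : Fin N) (a : State K) : M.waiting i a + M.joining i a = a := by
  unfold waiting joining
  cases M.discipline i
  · simp
  · exact update_add_single i a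

lemma joining_of_ne {i j : Fin N} (h : j ≠ i) (a : State K) : M.joining i a j = 0 := by
  unfold joining
  cases M.discipline i
  · rfl
  · exact Pi.single_eq_of_ne h _

lemma waiting_self_of_exhaustive {i : Fin N} (h : M.discipline i = .exhaustive) (a : State K) :
    M.waiting i a i = 0 := by
  simp [waiting, h]

lemma depart_add_customer (x : State K) (i : Fin N) (k : Fin (K i)) :
    depart (x + customer i k) i k = x := by
  ext j l
  rcases eq_or_ne j i with rfl | h
  · rcases eq_or_ne l k with rfl | h'
    · simp [depart, customer]
    · simp [depart, customer, h']
  · simp [depart, customer, h]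

/-- Continuation of a visit to queue `i`, when `s` are the customers still to be served, and `r` are
the other customers present. -/
noncomputable def continueVisit (i : Fin N) (n : ℕ) (r s y : State K) : ℝ≥0∞ :=
  M.visitIn i n (r + s) (s i) y

lemma visitIn_succ {i : Fin N} {g : Fin (K i) → ℕ} {k : Fin (K i)} (hk : 0 < g k)
    (hlt : ∀ l < k, g l = 0) (n : ℕ) (x y : State K) :
    M.visitIn i (n + 1) x g y = ∑' a, M.arrivals (M.service i k) a *
      M.visitIn i n (depart x i k + a) (M.entitled i g k (depart x i k + a)) y := by
  rw [visitIn, Finset.sum_eq_single k]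
  · rw [if_pos ⟨hk, hlt⟩]
  · rintro b - hb
    refine if_neg fun h => ?_
    rcases lt_or_gt_of_ne hb with h' | h'
    · exact h.1.ne' (hlt b h')
    · exact hk.ne' (h.2 k h')
  · simp

lemma visitIn_succ_zero (i : Fin N) (n : ℕ) (x y : State K) : M.visitIn i (n + 1) x 0 y = 0 := by
  simp [visitIn]

lemma exists_highest {n : ℕ} {g : Fin n → ℕ} (hg : g ≠ 0) : ∃ k, 0 < g k ∧ ∀ l < k, g l = 0 := by
  obtain ⟨k0, hk0⟩ := Function.ne_iff.1 hg
  obtain ⟨k, hk, hmin⟩ := WellFounded.has_min (wellFounded_lt (α := Fin n)) {k | g k ≠ 0} ⟨k0, hk0⟩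
  refine ⟨k, Nat.pos_of_ne_zero hk, fun l hl => ?_⟩
  by_contra h
  exact hmin l h hl

lemma continueVisit_zero {i : Fin N} {s : State K} (hs : ∀ j ≠ i, s j = 0) (r y : State K) :
    M.continueVisit i 0 r s y = if s = 0 ∧ r = y then 1 else 0 := by
  have h : s i = 0 ↔ s = 0 := by
    refine ⟨fun h => ?_, fun h => by simp [h]⟩
    ext1 j
    rcases eq_or_ne j i with rfl | hj
    · exact h
    · exact hs j hj
  simp only [continueVisit, visitIn, h]
  by_cases h0 : s = 0
  · simp [h0]
  · simp [h0]

/-- Under exhaustive service everybody in queue `i` must be counted in `s`, hence the condition `r i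
= 0`; it persists because `waiting` then leaves nobody in queue `i`. -/
lemma continueVisit_succ_of_highest {i : Fin N} {r s : State K} {k : Fin (K i)}
    (hr : M.discipline i = .exhaustive → r i = 0) (hlt : ∀ l < k, s i l = 0) (n : ℕ) (y : State K) :
    M.continueVisit i (n + 1) r (s + customer i k) y =
      ∑' a, M.arrivals (M.service i k) a *
        M.continueVisit i n (r + M.waiting i a) (s + M.joining i a) y := by
  have hi : (s + customer i k) i = s i + Pi.single k 1 := by simp [customer]
  rw [continueVisit, M.visitIn_succ (k := k) (by simp [hi])]
  · refine tsum_congr fun a => ?_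
    congr 1
    rw [← add_assoc, depart_add_customer, continueVisit]
    have h1 : r + M.waiting i a + (s + M.joining i a) = r + s + a := by
      rw [add_add_add_comm, waiting_add_joining]
    rw [h1]
    congr 1
    rw [hi, entitled]
    cases h : M.discipline i
    · ext l
      rcases eq_or_ne l k with rfl | hl
      · simp [joining, h]
      · simp [joining, h, hl]
    · simp [joining, h, hr h]
  · intro l hl
    simp [hi, hlt l hl, hl.ne]

lemma add_customer_apply_ne_zero (i : Fin N) (k : Fin (K i)) (s : State K) :
    (s + customer i k) i ≠ 0 := by
  intro h
  have := congrFun h k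
  simp [customer] at this

/-- The law of the outcome of a visit does not depend on which customer is served first. -/
lemma continueVisit_succ {i : Fin N} (n : ℕ) : ∀ {r s : State K} (k : Fin (K i)),
    (∀ j ≠ i, s j = 0) → (M.discipline i = .exhaustive → r i = 0) → ∀ y : State K,
    M.continueVisit i (n + 1) r (s + customer i k) y =
      ∑' a, M.arrivals (M.service i k) a *
        M.continueVisit i n (r + M.waiting i a) (s + M.joining i a) y := by
  induction n using Nat.strong_induction_on with
  | h n ih =>
  intro r s k hs hr y
  obtain ⟨l, hl, hlt⟩ := exists_highest (add_customer_apply_ne_zero i k s)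
  have hlk : l ≤ k := by
    by_contra! h
    have := hlt k h
    simp [customer] at this
  rcases hlk.eq_or_lt with rfl | hlk
  · refine M.continueVisit_succ_of_highest hr (fun l' hl' => ?_) n y
    have := hlt l' hl'
    simpa [customer, hl'.ne] using this
  -- The server takes a customer of level `l`, strictly higher than `k`, so both a level `l` and a
  -- level `k` customer can be split off.
  have hl' : 0 < s i l := by simpa [customer, hlk.ne] using hl
  obtain ⟨s, rfl⟩ := exists_eq_add_customer hl'
  have hs' : ∀ j ≠ i, s j = 0 := fun j hj => by
    simpa [customer, Pi.single_eq_of_ne hj] using hs j hj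
  have hcomm : s + customer i l + customer i k = s + customer i k + customer i l :=
    add_right_comm _ _ _
  rw [hcomm] at hlt ⊢
  rw [M.continueVisit_succ_of_highest hr (fun l' hl' => by
    simpa [customer, hl'.ne] using hlt l' hl')]
  -- With a single service left both sides vanish, as the other customer remains unserved.
  cases n with
  | zero =>
    have hz : ∀ (k' : Fin (K i)) (r a : State K),
        M.continueVisit i 0 r (s + customer i k' + a) y = 0 := by
      intro k' r a
      simp only [continueVisit, visitIn]
      rw [if_neg]
      rintro ⟨h, -⟩
      rw [add_right_comm] at h
      exact add_customer_apply_ne_zero _ _ _ h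
    simp only [hz, mul_zero]
  | succ n =>
    -- By induction the second service may go to the other of the two customers. Both sides then
    -- differ only in the order of two independent services, and the sums are interchanged.
    have key : ∀ a (k' : Fin (K i)),
        M.continueVisit i (n + 1) (r + M.waiting i a) (s + customer i k' + M.joining i a) y =
          ∑' b, M.arrivals (M.service i k') b * M.continueVisit i n
            (r + M.waiting i a + M.waiting i b) (s + M.joining i a + M.joining i b) y := by
      intro a k'
      rw [add_right_comm]
      exact ih n n.lt_succ_self k' (fun j hj => by simp [hs' j hj, M.joining_of_ne hj])
        (fun h => by simp [hr h, M.waiting_self_of_exhaustive h]) y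
    simp only [key, ← ENNReal.tsum_mul_left]
    rw [ENNReal.tsum_comm]
    refine tsum_congr fun b => tsum_congr fun a => ?_
    rw [add_right_comm r, add_right_comm s]
    ring

/-! ### Labelling intertwines the transitions. -/

lemma apply_eq_zero_of_total_eq {x : State K} {m : State (fun _ : Fin N => 1)} (hx : total x = m)
    {j : Fin N} (h : m j = 0) : x j = 0 :=
  apply_eq_zero_of_total (by rw [hx, h])

/-- The levels of the customers of queue `i` and of the others may be chosen separately. -/
lemma labelMean_update_single (i : Fin N) (m : State (fun _ : Fin N => 1))
    (F : State K → State K → ℝ≥0∞) :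
    M.labelMean m (fun x => F (Function.update x i 0) (Pi.single i (x i))) =
      M.labelMean (Function.update m i 0) fun r => M.labelMean (Pi.single i (m i)) (F r) := by
  conv_lhs => rw [← update_add_single i m, labelMean_add]
  refine M.labelMean_congr fun r hr => M.labelMean_congr fun s hs => ?_
  have hri : r i = 0 := apply_eq_zero_of_total_eq hr (by simp)
  have hsj : ∀ j ≠ i, s j = 0 := fun j hj => apply_eq_zero_of_total_eq hs (by simp [hj])
  congr 1
  · ext1 j
    rcases eq_or_ne j i with rfl | h
    · simp [hri]
    · simp [h, hsj j h]
  · ext1 j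
    rcases eq_or_ne j i with rfl | h
    · simp [hri]
    · simp [h, hsj j h]

lemma labelMean_waiting_joining (i : Fin N) (m : State (fun _ : Fin N => 1))
    (F : State K → State K → ℝ≥0∞) :
    M.labelMean m (fun x => F (M.waiting i x) (M.joining i x)) =
      M.labelMean (M.withoutPriorities.waiting i m) fun r =>
        M.labelMean (M.withoutPriorities.joining i m) (F r) := by
  cases h : M.discipline i
  · have h' : M.withoutPriorities.discipline i = .gated := h
    simp [waiting, joining, h, h', labelMean_zero]
  · have h' : M.withoutPriorities.discipline i = .exhaustive := h
    simp only [waiting, joining, h, h']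
    exact M.labelMean_update_single i m F

/-- One service at a time: the customer taken may be one whose level is still random, and the
arrivals during his service are labelled independently of everybody else, so the labelled form of
the claim is restored for `n` services. -/
lemma labelMean_continueVisit (i : Fin N) (n : ℕ) : ∀ (r s : State (fun _ : Fin N => 1)),
    (∀ j ≠ i, s j = 0) → (M.discipline i = .exhaustive → r i = 0) → ∀ y : State K,
    M.labelMean r (fun r' => M.labelMean s fun s' => M.continueVisit i n r' s' y) =
      M.withoutPriorities.continueVisit i n r s (total y) * M.labelWeight y := by
  induction n with
  | zero =>
    intro r s hs hr y
    rw [continueVisit_zero _ hs]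
    have h1 : ∀ r' : State K, M.labelMean s (fun s' => M.continueVisit i 0 r' s' y) =
        if s = 0 then (if r' = y then 1 else 0) else 0 := by
      intro r'
      -- The integrand is constant on the fibre, and the weights there sum to `1`.
      rw [M.labelMean_congr (G := fun _ => (if s = 0 then (if r' = y then 1 else 0) else 0) * 1),
        labelMean_const_mul, labelMean_one, mul_one]
      intro s' hs'
      rw [continueVisit_zero _ fun j hj => apply_eq_zero_of_total_eq hs' (hs j hj)]
      have hs0 : s' = 0 ↔ s = 0 := by rw [← total_eq_zero_iff, hs']
      by_cases h0 : s = 0 <;> simp [hs0, h0]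
    simp only [h1]
    by_cases h0 : s = 0
    · simp [h0, labelMean_ite_eq]
    · simp [h0, labelMean]
  | succ n ih =>
    intro r s hs hr y
    have hr' : ∀ {r' : State K}, total r' = r → M.discipline i = .exhaustive → r' i = 0 :=
      fun h h' => apply_eq_zero_of_total_eq h (hr h')
    -- With nobody to serve, a visit cannot take `n + 1` services, and both sides vanish.
    by_cases h0 : s i = 0
    · have hz : ∀ r', M.labelMean s (fun s' => M.continueVisit i (n + 1) r' s' y) = 0 := by
        intro r'
        rw [M.labelMean_congr (G := fun _ => 0 * 1), labelMean_const_mul, zero_mul]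
        intro s' hs'
        rw [continueVisit, apply_eq_zero_of_total_eq hs' h0, visitIn_succ_zero, zero_mul]
      simp only [hz]
      rw [continueVisit, h0, visitIn_succ_zero, zero_mul]
      simp [labelMean]
    · obtain ⟨s, rfl⟩ : ∃ s', s = s' + customer i 0 := by
        refine exists_eq_add_customer (Nat.pos_of_ne_zero fun h => h0 ?_)
        ext l
        rwa [Subsingleton.elim l 0]
      have hs : ∀ j ≠ i, s j = 0 := fun j hj => by
        simpa [customer, Pi.single_eq_of_ne hj] using hs j hj
      rw [continueVisit_succ _ n 0 hs hr]
      calc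
        M.labelMean r (fun r' => M.labelMean (s + customer i 0) fun s' =>
            M.continueVisit i (n + 1) r' s' y)
          = M.labelMean r (fun r' => M.labelMean s fun s' =>
              ∑' a, (∑ k, M.levelProb i k * M.arrivals (M.service i k) a) *
                M.continueVisit i n (r' + M.waiting i a) (s' + M.joining i a) y) := by
            refine M.labelMean_congr fun r' hr'' => ?_
            rw [labelMean_add_customer]
            simp only [← labelMean_const_mul]
            rw [← labelMean_sum]
            refine M.labelMean_congr fun s' hs' => ?_
            simp only [Finset.sum_mul]
            rw [Summable.tsum_finsetSum fun _ _ => ENNReal.summable]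
            refine Finset.sum_congr rfl fun k _ => ?_
            rw [M.continueVisit_succ n k
              (fun j hj => apply_eq_zero_of_total_eq hs' (hs j hj)) (hr' hr''),
              ← ENNReal.tsum_mul_left]
            simp only [mul_assoc]
        _ = M.labelMean r (fun r' => M.labelMean s fun s' =>
              ∑' α, M.withoutPriorities.arrivals (M.mixedService i) α *
                M.labelMean (M.withoutPriorities.waiting i α) fun a =>
                  M.labelMean (M.withoutPriorities.joining i α) fun b =>
                    M.continueVisit i n (r' + a) (s' + b) y) := by
            refine M.labelMean_congr fun r' _ => M.labelMean_congr fun s' _ => ?_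
            simp only [M.arrivals_eq, ← mul_assoc, ← Finset.sum_mul, sum_levelProb_mul_arrivals]
            rw [M.tsum_total_mul]
            refine tsum_congr fun α => ?_
            congr 1
            exact M.labelMean_waiting_joining i α
              fun a b => M.continueVisit i n (r' + a) (s' + b) y
        _ = ∑' α, M.withoutPriorities.arrivals (M.mixedService i) α *
              M.labelMean (r + M.withoutPriorities.waiting i α) fun r' =>
                M.labelMean (s + M.withoutPriorities.joining i α) fun s' =>
                  M.continueVisit i n r' s' y := by
            simp only [labelMean_tsum, labelMean_const_mul]
            refine tsum_congr fun α => ?_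
            congr 1
            simp only [labelMean_add]
            refine M.labelMean_congr fun r' _ => ?_
            rw [labelMean_comm]
        _ = _ := by
            rw [← ENNReal.tsum_mul_right]
            refine tsum_congr fun α => ?_
            rw [ih, mul_assoc]
            · rfl
            · intro j hj
              simp [hs j hj, joining_of_ne _ hj]
            · intro h
              have h' : M.withoutPriorities.discipline i = .exhaustive := h
              simp [hr h, waiting_self_of_exhaustive _ h']

lemma visit_eq_tsum_continueVisit (i : Fin N) (x y : State K) :
    M.visit i x y =
      ∑' n, M.continueVisit i n (Function.update x i 0) (Pi.single i (x i)) y := by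
  simp only [visit, continueVisit, update_add_single, Pi.single_eq_same]

lemma labelMean_visit (i : Fin N) (m : State (fun _ : Fin N => 1)) (y : State K) :
    M.labelMean m (fun x => M.visit i x y) =
      M.withoutPriorities.visit i m (total y) * M.labelWeight y := by
  simp only [visit_eq_tsum_continueVisit]
  rw [labelMean_tsum, ← ENNReal.tsum_mul_right]
  refine tsum_congr fun n => ?_
  rw [M.labelMean_update_single i m fun r s => M.continueVisit i n r s y]
  refine M.labelMean_continueVisit i n _ _ (fun j hj => by simp [hj]) (fun _ => by simp) y

lemma switch_eq (i : Fin N) (x y : State K) :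
    M.switch i x y = ∑' a, M.arrivals (M.switchover i) a * if x + a = y then 1 else 0 := by
  rw [switch]
  refine tsum_congr fun a => ?_
  split_ifs <;> simp

lemma labelMean_switch (i : Fin N) (m : State (fun _ : Fin N => 1)) (y : State K) :
    M.labelMean m (fun x => M.switch i x y) =
      M.withoutPriorities.switch i m (total y) * M.labelWeight y := by
  simp only [switch_eq, arrivals_eq M, tsum_total_mul]
  rw [labelMean_tsum, ← ENNReal.tsum_mul_right]
  refine tsum_congr fun α => ?_
  rw [labelMean_const_mul, ← labelMean_add M m α (fun x => if x = y then 1 else 0),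
    labelMean_ite_eq, mul_assoc]
  congr 1
  split_ifs <;> simp

/-- Random labelling intertwines the transitions with and without priorities. -/
lemma labelMean_step (i : Fin N) (m : State (fun _ : Fin N => 1)) (y : State K) :
    M.labelMean m (fun x => M.step i x y) =
      M.withoutPriorities.step i m (total y) * M.labelWeight y := by
  simp only [step]
  rw [labelMean_tsum]
  calc
    ∑' u, M.labelMean m (fun x => M.visit i x u * M.switch i u y)
      = ∑' u, M.withoutPriorities.visit i m (total u) * M.labelWeight u * M.switch i u y := by
        refine tsum_congr fun u => ?_
        simp only [mul_comm _ (M.switch i u y)]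
        rw [labelMean_const_mul, labelMean_visit]
    _ = _ := by
        rw [M.tsum_total_mul (M.withoutPriorities.visit i m), ← ENNReal.tsum_mul_right]
        refine tsum_congr fun α => ?_
        rw [labelMean_switch, mul_assoc]

/-! ### Labelled laws and their generating functions. -/

/-- The law of the joint queue lengths when the customers get independent random levels. -/
noncomputable def labelled (p : PMF (State (fun _ : Fin N => 1))) : PMF (State K) :=
  ⟨fun x => p (total x) * M.labelWeight x, by
    have h := M.tsum_total_mul p (fun _ => 1)
    simp only [mul_one, labelMean_one, p.tsum_coe] at h
    rw [← h]
    exact ENNReal.summable.hasSum⟩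

lemma labelled_apply (p : PMF (State (fun _ : Fin N => 1))) (x : State K) :
    M.labelled p x = p (total x) * M.labelWeight x := rfl

lemma isSteadyState_labelled [NeZero N] {P : Fin N → PMF (State (fun _ : Fin N => 1))}
    (hP : M.withoutPriorities.IsSteadyState P) : M.IsSteadyState fun i => M.labelled (P i) := by
  intro i y
  simp only [labelled_apply]
  rw [M.tsum_total_mul (P i), hP i, ← ENNReal.tsum_mul_right]
  refine tsum_congr fun m => ?_
  rw [labelMean_step, mul_assoc]

/-- The fibres of `total` are finite products of antidiagonals, the index sets of the multinomial
theorem. -/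
lemma total_preimage_singleton (m : State (fun _ : Fin N => 1)) :
    (total : State K → _) ⁻¹' {m} =
      (Fintype.piFinset fun j => Finset.piAntidiag Finset.univ (m j 0) : Finset (State K)) := by
  ext x
  simp only [Set.mem_preimage, Set.mem_singleton_iff, Finset.mem_coe, Fintype.mem_piFinset,
    Finset.mem_piAntidiag]
  refine ⟨fun h j => ⟨?_, fun i _ => Finset.mem_univ i⟩, fun h => ?_⟩
  · rw [← h]
    rfl
  · ext j l
    rw [Subsingleton.elim l 0]
    exact (h j).1

/-- The generating function of the levels of customers whose numbers are `m`. -/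
lemma sum_labelWeight_mul_pow (m : State (fun _ : Fin N => 1))
    (z : (j : Fin N) → Fin (K j) → ℂ) :
    ∑' x : (total : State K → _) ⁻¹' {m},
        ((M.labelWeight x.1 : ℝ) : ℂ) * ∏ j, ∏ k, z j k ^ x.1 j k =
      ∏ j, (∑ k, ((M.levelProb j k : ℝ) : ℂ) * z j k) ^ m j 0 := by
  rw [total_preimage_singleton, Finset.tsum_subtype' _
    fun x : State K => ((M.labelWeight x : ℝ) : ℂ) * ∏ j, ∏ k, z j k ^ x j k]
  simp only [Finset.sum_pow_eq_sum_piAntidiag, Finset.prod_univ_sum]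
  refine Finset.sum_congr rfl fun x _ => ?_
  rw [labelWeight]
  push_cast
  simp only [mul_pow, Finset.prod_mul_distrib, mul_assoc]

lemma genFun_labelled (p : PMF (State (fun _ : Fin N => 1))) (z : (j : Fin N) → Fin (K j) → ℂ)
    (hz : ∀ j k, ‖z j k‖ ≤ 1) :
    genFun (M.labelled p) z = genFun p fun j _ =>
      (1 / ((M.totalRate j : ℝ) : ℂ)) * ∑ k, ((M.rate j k : ℝ) : ℂ) * z j k := by
  have hsum : Summable fun x : State K =>
      ((M.labelled p x).toReal : ℂ) * ∏ j, ∏ k, z j k ^ x j k := by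
    refine Summable.of_norm_bounded (ENNReal.summable_toReal (M.labelled p).tsum_coe_ne_top)
      fun x => ?_
    rw [norm_mul, Complex.norm_real, Real.norm_of_nonneg ENNReal.toReal_nonneg]
    refine mul_le_of_le_one_right ENNReal.toReal_nonneg ?_
    simp only [norm_prod, norm_pow]
    exact Finset.prod_le_one (fun _ _ => Finset.prod_nonneg fun _ _ => by positivity) fun j _ =>
      Finset.prod_le_one (fun _ _ => by positivity) fun k _ =>
        pow_le_one₀ (norm_nonneg _) (hz j k)
  -- Absolute convergence on the closed polydisc allows grouping by the numbers in each queue.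
  rw [genFun, ← (hsum.hasSum.tsum_fiberwise total).tsum_eq, genFun]
  refine tsum_congr fun m => ?_
  have h1 : ∀ x : (total : State K → _) ⁻¹' {m},
      ((M.labelled p x.1).toReal : ℂ) * ∏ j, ∏ k, z j k ^ x.1 j k =
        ((p m).toReal : ℂ) *
          (((M.labelWeight x.1 : ℝ) : ℂ) * ∏ j, ∏ k, z j k ^ x.1 j k) := by
    rintro ⟨x, rfl⟩
    rw [labelled_apply]
    simp [mul_assoc]
  rw [tsum_congr h1, tsum_mul_left, sum_labelWeight_mul_pow]
  congr 1
  refine Finset.prod_congr rfl fun j _ => ?_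
  simp only [Finset.univ_unique, Finset.prod_singleton, Fin.default_eq_zero]
  congr 1
  rw [Finset.mul_sum]
  refine Finset.sum_congr rfl fun k _ => ?_
  rw [levelProb]
  push_cast
  ring

/-! ### Total mass and positivity of the transitions. -/

lemma sum_tsum_visitIn_le_one (i : Fin N) (m : ℕ) : ∀ (x : State K) (g : Fin (K i) → ℕ),
    ∑ n ∈ Finset.range m, ∑' y, M.visitIn i n x g y ≤ 1 := by
  induction m with
  | zero => simp
  | succ m ih =>
    intro x g
    rw [Finset.sum_range_succ']
    by_cases hg : g = 0
    · subst hg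
      simp [visitIn]
    · obtain ⟨k, hk, hlt⟩ := exists_highest hg
      have h0 : ∑' y, M.visitIn i 0 x g y = 0 := by simp [visitIn, hg]
      simp only [h0, add_zero, M.visitIn_succ hk hlt]
      calc
        _ = ∑' a, M.arrivals (M.service i k) a * ∑ n ∈ Finset.range m, ∑' y,
              M.visitIn i n (depart x i k + a) (M.entitled i g k (depart x i k + a)) y := by
            simp only [Finset.mul_sum]
            rw [Summable.tsum_finsetSum fun _ _ => ENNReal.summable]
            refine Finset.sum_congr rfl fun n _ => ?_
            rw [ENNReal.tsum_comm]
            simp only [ENNReal.tsum_mul_left]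
        _ ≤ ∑' a, M.arrivals (M.service i k) a * 1 :=
            ENNReal.tsum_le_tsum fun a => mul_le_mul_right (ih _ _) _
        _ = 1 := by simp [tsum_arrivals]

lemma tsum_visit_le_one (i : Fin N) (x : State K) : ∑' y, M.visit i x y ≤ 1 := by
  simp only [visit]
  rw [ENNReal.tsum_comm, ENNReal.tsum_eq_iSup_nat]
  exact iSup_le fun m => M.sum_tsum_visitIn_le_one i m x (x i)

lemma tsum_switch (i : Fin N) (x : State K) : ∑' y, M.switch i x y = 1 := by
  simp only [switch_eq]
  rw [ENNReal.tsum_comm]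
  simp [tsum_arrivals]

lemma tsum_step_le_one (i : Fin N) (x : State K) : ∑' y, M.step i x y ≤ 1 := by
  simp only [step]
  rw [ENNReal.tsum_comm]
  simpa [ENNReal.tsum_mul_left, tsum_switch] using M.tsum_visit_le_one i x

lemma tsum_mul_step_le (i : Fin N) (g : State K → ℝ≥0∞) :
    ∑' y, ∑' x, g x * M.step i x y ≤ ∑' x, g x := by
  rw [ENNReal.tsum_comm]
  refine ENNReal.tsum_le_tsum fun x => ?_
  rw [ENNReal.tsum_mul_left]
  exact mul_le_of_le_one_right' (M.tsum_step_le_one i x)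

/-- With positive probability nobody arrives during any of the services, so exactly `s` is removed.
-/
lemma exists_continueVisit_pos {i : Fin N} (r s : State K) (hs : ∀ j ≠ i, s j = 0)
    (hr : M.discipline i = .exhaustive → r i = 0) : ∃ n, 0 < M.continueVisit i n r s r := by
  induction s using State.induction with
  | zero => exact ⟨0, by simp [continueVisit_zero]⟩
  | step s j k ih =>
    have hj : j = i := by
      by_contra h
      exact add_customer_apply_ne_zero j k s (hs j h)
    subst hj
    have hs' : ∀ l ≠ j, s l = 0 := fun l hl => by
      simpa [customer, Pi.single_eq_of_ne hl] using hs l hl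
    obtain ⟨n, hn⟩ := ih hs'
    refine ⟨n + 1, ?_⟩
    rw [M.continueVisit_succ n k hs' hr]
    refine lt_of_lt_of_le ?_ (ENNReal.le_tsum 0)
    have h0 : M.waiting j 0 = 0 ∧ M.joining j 0 = 0 := by
      unfold waiting joining
      cases M.discipline j <;> simp
    rw [h0.1, h0.2, add_zero, add_zero]
    exact ENNReal.mul_pos (M.arrivals_zero_pos _).ne' hn.ne'

/-- With positive probability nobody arrives until the next visit beginning. -/
lemma step_update_pos (i : Fin N) (x : State K) : 0 < M.step i x (Function.update x i 0) := by
  refine lt_of_lt_of_le (ENNReal.mul_pos ?_ ?_) (ENNReal.le_tsum (Function.update x i 0))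
  · obtain ⟨n, hn⟩ := M.exists_continueVisit_pos (i := i) (Function.update x i 0)
      (Pi.single i (x i)) (fun j hj => by simp [hj]) (fun _ => by simp)
    rw [visit_eq_tsum_continueVisit]
    exact (hn.trans_le (ENNReal.le_tsum n)).ne'
  · rw [switch_eq]
    refine (lt_of_lt_of_le ?_ (ENNReal.le_tsum 0)).ne'
    simpa using M.arrivals_zero_pos _

/-! ### Uniqueness of the steady state. -/

lemma eq_of_le_of_tsum_le {α : Type*} {f g : α → ℝ≥0∞} (h : ∀ a, f a ≤ g a)
    (hf : ∑' a, f a ≠ ∞) (hgf : ∑' a, g a ≤ ∑' a, f a) : f = g := by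
  ext a
  by_contra hne
  exact (ENNReal.tsum_lt_tsum hf h (lt_of_le_of_ne (h a) hne)).not_ge hgf

section Uniqueness

variable [NeZero N]

-- Without arrivals each visit empties its queue, so one full cycle leads from any charged state to
-- the empty one.
open Fin.CommRing in
lemma reaches_zero {g : Fin N → State K → ℝ≥0∞}
    (hg : ∀ i y, g (i + 1) y = ∑' x, g i x * M.step i x y) {i : Fin N} {x : State K}
    (hx : 0 < g i x) : 0 < g i 0 := by
  have h : ∀ n : ℕ, ∃ x, 0 < g (i + (n : Fin N)) x ∧
      ∀ m < n, x (i + (m : Fin N)) = 0 := by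
    intro n
    induction n with
    | zero => exact ⟨x, by simpa using hx, by simp⟩
    | succ n ih =>
      obtain ⟨x, hx, hx0⟩ := ih
      refine ⟨Function.update x (i + (n : Fin N)) 0, ?_, fun m hm => ?_⟩
      · rw [Nat.cast_succ, ← add_assoc, hg]
        exact lt_of_lt_of_le (ENNReal.mul_pos hx.ne' (M.step_update_pos _ x).ne')
          (ENNReal.le_tsum x)
      · by_cases h : i + (m : Fin N) = i + (n : Fin N)
        · rw [h, Function.update_self]
        · rw [Function.update_of_ne h]
          refine hx0 m (lt_of_le_of_ne (Nat.lt_succ_iff.1 hm) ?_)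
          rintro rfl
          exact h rfl
  -- After `N` steps every queue has been visited, queue `j` at step `j - i`, and `N = 0` in `Fin N`
  -- leads back to `i`.
  obtain ⟨x, hx, hx0⟩ := h N
  have h0 : x = 0 := by
    ext1 j
    have := hx0 (j - i).val (j - i).isLt
    rwa [Fin.cast_val_eq_self, add_sub_cancel] at this
  simpa [h0] using hx

variable {P Q : Fin N → PMF (State K)}

/-- Truncated subtraction is the positive part: `P ≤ (P - Q) + Q` pointwise, and the transitions
reproduce `P` and `Q`. -/
lemma IsSteadyState.tsub_le (hP : M.IsSteadyState P) (hQ : M.IsSteadyState Q) (i : Fin N)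
    (y : State K) :
    P (i + 1) y - Q (i + 1) y ≤ ∑' x, (P i x - Q i x) * M.step i x y := by
  rw [tsub_le_iff_right, hP, hQ, ← ENNReal.tsum_add]
  refine ENNReal.tsum_le_tsum fun x => ?_
  rw [← add_mul]
  exact mul_le_mul_left le_tsub_add _

-- The mass of the positive part cannot increase at any step, yet it returns to its value after a
-- cycle. So it is constant, and the pointwise inequality of `tsub_le` must be an equality.
open Fin.CommRing in
lemma IsSteadyState.tsub_eq (hP : M.IsSteadyState P) (hQ : M.IsSteadyState Q) (i : Fin N)
    (y : State K) :
    P (i + 1) y - Q (i + 1) y = ∑' x, (P i x - Q i x) * M.step i x y := by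
  have hmono : ∀ i, ∑' y, (P (i + 1) y - Q (i + 1) y) ≤ ∑' x, (P i x - Q i x) := fun i =>
    (ENNReal.tsum_le_tsum (IsSteadyState.tsub_le M hP hQ i)).trans (M.tsum_mul_step_le i _)
  have hmono' : ∀ (i : Fin N) (n : ℕ),
      ∑' y, (P (i + (n : Fin N)) y - Q (i + (n : Fin N)) y) ≤ ∑' x, (P i x - Q i x) := by
    intro i n
    induction n with
    | zero => simp
    | succ n ih =>
      rw [Nat.cast_succ, ← add_assoc]
      exact (hmono _).trans ih
  have hback : ∑' x, (P i x - Q i x) ≤ ∑' y, (P (i + 1) y - Q (i + 1) y) := by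
    -- The value of `-1` is `N - 1`, the number of steps from `i + 1` round to `i`.
    have := hmono' (i + 1) (-1 : Fin N).val
    rwa [Fin.cast_val_eq_self, add_neg_cancel_right] at this
  have hfin : ∑' y, (P (i + 1) y - Q (i + 1) y) ≠ ∞ :=
    ne_top_of_le_ne_top (P (i + 1)).tsum_coe_ne_top (ENNReal.tsum_le_tsum fun _ => tsub_le_self)
  exact congrFun (eq_of_le_of_tsum_le (IsSteadyState.tsub_le M hP hQ i) hfin
    ((M.tsum_mul_step_le i _).trans hback)) y

lemma exists_lt_of_ne {α : Type*} {p q : PMF α} (h : p ≠ q) : ∃ a, q a < p a := by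
  by_contra! hle
  refine h (PMF.ext fun a => congrFun (eq_of_le_of_tsum_le hle p.tsum_coe_ne_top ?_) a)
  rw [p.tsum_coe, q.tsum_coe]

lemma IsSteadyState.unique (hP : M.IsSteadyState P) (hQ : M.IsSteadyState Q) : P = Q := by
  ext1 i
  by_contra hne
  -- Distinct laws of mass one exceed each other somewhere; by invariance of the positive part the
  -- excess is carried to the empty state.
  have key : ∀ {P Q : Fin N → PMF (State K)}, M.IsSteadyState P → M.IsSteadyState Q →
      P i ≠ Q i → Q i 0 < P i 0 := by
    intro P Q hP hQ h
    obtain ⟨x, hx⟩ := exists_lt_of_ne h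
    exact tsub_pos_iff_lt.1 (M.reaches_zero (g := fun i x => P i x - Q i x)
      (IsSteadyState.tsub_eq M hP hQ) (tsub_pos_iff_lt.2 hx))
  exact lt_asymm (key hP hQ hne) (key hQ hP (Ne.symm hne))

end Uniqueness

end System
end Polling

theorem lemma1 {N : ℕ} [NeZero N] {K : Fin N → ℕ} (M : Polling.System N K) (hρ : M.load < 1)
    (P : Fin N → PMF (Polling.State (fun _ : Fin N => 1)))
    (hP : M.withoutPriorities.IsSteadyState P) :
    (∃! P' : Fin N → PMF (Polling.State K), M.IsSteadyState P') ∧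
    ∀ P' : Fin N → PMF (Polling.State K), M.IsSteadyState P' →
      ∀ (i : Fin N) (z : (j : Fin N) → Fin (K j) → ℂ), (∀ j k, ‖z j k‖ ≤ 1) →
        Polling.genFun (P' i) z =
          Polling.genFun (P i) (fun j _ =>
            (1 / ((M.totalRate j : ℝ) : ℂ)) * ∑ k, ((M.rate j k : ℝ) : ℂ) * z j k) := by
  have h := M.isSteadyState_labelled hP
  refine ⟨⟨_, h, fun P' hP' => hP'.unique M h⟩, fun P' hP' i z hz => ?_⟩
  rw [hP'.unique M h]
  exact M.genFun_labelled (P i) z hz
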